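/- Let $\mathcal B$ be a de Branges space, that is, a nontrivial Hilbert space of entire functions (inner product $\langle\cdot,\cdot\rangle_0$ antilinear in the first argument) such that evaluation at every non-real point is continuous; if $w$ is a non-real zero of $f\in\mathcal B$, then $f(z)\frac{z-\bar w}{z-w}$ belongs to $\mathcal B$ and has the same norm as $f$; and $f^\#(z)=\overline{f(\bar z)}$ belongs to $\mathcal B$ and has the same norm as $f$. Let $e$ be a Hermite–Biehler function (entire, $|e^\#(z)|<|e(z)|$ for $\operatorname{Im}z>0$) with $e(x)\ne0$ for all $x\in\mathbb R$ and with $\mathcal B=\mathcal B(e)$ as Hilbert spaces, where $\mathcal B(e)$ is the set of entire $f$ for which $f/e$ and $f^\#/e$ belong to the Hardy space $H^2(\mathbb C^+)$, with $\langle f,g\rangle_0=\int_{\mathbb R}\overline{f(x)}g(x)|e(x)|^{-2}dx$. Let $k(\cdot,w)\in\mathcal B$ denote the reproducing kernel, $\langle k(\cdot,w),f\rangle_0=f(w)$ for all $f\in\mathcal B$, $w\in\mathbb C$. Let $S$ be the operator of multiplication by $z$ in $\mathcal B$ with domain $\{f\in\mathcal B: zf\in\mathcal B\}$, and assume that this domain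 is dense in $\mathcal B$. Let $n\in\{0,1,2,\dots\}$. The Gelfand triplet $\{\mathcal B_{+n},\mathcal B,\mathcal B_{-n}\}$ is built as follows. $\mathcal B_{-n}$ is the Hilbert space $\mathcal B+z\mathcal B+\dots+z^n\mathcal B$ with inner product $$\langle f,g\rangle_{-n}=\int_{\mathbb R}\frac{\overline{f(x)}g(x)}{(x^2+1)^n|e(x)|^2}\,dx .$$ $D:\mathcal B_{-n}\to\mathcal B$ is the adjoint of the inclusion $\mathcal B\subset\mathcal B_{-n}$; its restriction to $\mathcal B$ is injective. $\mathcal B_{+n}$ is the completion of $D\mathcal B$ with respect to the inner product $\langle f,g\rangle_{+n}=\langle f,D^{-1}g\rangle_0$. $T:\mathcal B_{+n}\to\mathcal B_{-n}$ is the extension by continuity of $D^{-1}:D\mathcal B\to\mathcal B\subset\mathcal B_{-n}$. The duality bracket is $[h,f]=\langle Th,f\rangle_{-n}$ for $h\in\mathcal B_{+n}$, $f\in\mathcal B_{-n}$. An operator $A$ in a Hilbert space $\mathcal H$ is called $n$-entire if it is closed, symmetric, has deficiency indices $(1,1)$, is regular (for every $z\in\mathbb C$ there is $d_z>0$ with $\|(A-zI)\psi\|\ge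 d_z\|\psi\|$ for all $\psi\in\operatorname{dom}(A)$), and there exist $\mu_0,\dots,\mu_n\in\mathcal H$ such that $\mathcal H=\operatorname{ran}(A-zI)\dotplus\operatorname{span}\{\mu_0+z\mu_1+\dots+z^n\mu_n\}$ for all $z\in\mathbb C$. Then the continuous extension $\mathcal B_{+n}\to\mathcal B$ of the inclusion $D\mathcal B\subset\mathcal B$ is injective, so that $\mathcal B_{+n}$ is a subspace of $\mathcal B$; $k(\cdot,z)\in\mathcal B_{+n}$ for every $z\in\mathbb C$; and $S$ is $n$-entire if and only if there exists an (entire) function $m\in\mathcal B_{-n}$ such that $[k(\cdot,z),m]\neq0$ for every $z\in\mathbb C$. -/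

import Mathlib

open scoped ComplexConjugate NNReal

noncomputable section

namespace DeBranges

/-! ### Closed symmetric operators and the class of `n`-entire operators -/

section Operators

variable {H : Type*} [NormedAddCommGroup H] [InnerProductSpace ℂ H]

/-- The range `ran (A - z I)` of a (not necessarily densely defined) operator `A` in `H`. -/
def shiftRange (A : H →ₗ.[ℂ] H) (z : ℂ) : Submodule ℂ H :=
  LinearMap.range (A.toFun - z • A.domain.subtype)

/-- The class of regular, closed, symmetric operators with deficiency indices `(1, 1)`.
Since `ran (A - z I)ᗮ = ker (A^* - conj z I)`, where `A^*` is the (possibly multivalued) adjoint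
relation, the deficiency indices are expressed through the defect spaces `ran (A - z I)ᗮ`,
`z` non-real. -/
structure IsRegularSymmetric (A : H →ₗ.[ℂ] H) : Prop where
  closed : A.IsClosed
  symmetric : ∀ x y : A.domain, inner ℂ (A x) (y : H) = inner ℂ (x : H) (A y)
  deficiency : ∀ z : ℂ, z.im ≠ 0 → Module.finrank ℂ (shiftRange A z)ᗮ = 1
  regular : ∀ z : ℂ, ∃ d : ℝ, 0 < d ∧ ∀ x : A.domain, d * ‖(x : H)‖ ≤ ‖A x - z • (x : H)‖

/-- `A` is `n`-entire: it is a regular, closed, symmetric operator with deficiency indices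
`(1, 1)`, and there are `μ 0, …, μ n` such that, for every `z`, the space `H` is the (algebraic)
direct sum of `ran (A - z I)` and the span of `μ 0 + z μ 1 + ⋯ + z ^ n μ n`. -/
def IsNEntire (n : ℕ) (A : H →ₗ.[ℂ] H) : Prop :=
  IsRegularSymmetric A ∧
    ∃ μ : Fin (n + 1) → H, ∀ z : ℂ,
      IsCompl (shiftRange A z) (Submodule.span ℂ {∑ j : Fin (n + 1), z ^ (j : ℕ) • μ j})

end Operators

/-! ### De Branges spaces -/

/-- A de Branges space: a nontrivial Hilbert space `B` of entire functions (the element `f : B`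
is the function `eval f`) with the three axioms of de Branges. -/
class DeBrangesSpace (B : Type*) [NormedAddCommGroup B] [InnerProductSpace ℂ B]
    [CompleteSpace B] where
  /-- The entire function that an element of the space is. -/
  eval : B →ₗ[ℂ] (ℂ → ℂ)
  eval_injective : Function.Injective eval
  differentiable_eval : ∀ f : B, Differentiable ℂ (eval f)
  exists_ne_zero : ∃ f : B, f ≠ 0
  /-- Evaluation at a non-real point is continuous. -/
  continuous_eval : ∀ w : ℂ, w.im ≠ 0 → Continuous fun f : B => eval f w
  /-- If `w` is a non-real zero of `f`, then `f(z) (z - conj w) / (z - w)` belongs to the space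
  and has the same norm as `f`. -/
  blaschke : ∀ (f : B) (w : ℂ), w.im ≠ 0 → eval f w = 0 →
    ∃ g : B, ‖g‖ = ‖f‖ ∧ ∀ z : ℂ, (z - w) * eval g z = (z - conj w) * eval f z
  /-- The function `f^#(z) = conj (f (conj z))` belongs to the space and has the same norm
  as `f`. -/
  sharp_mem : ∀ f : B, ∃ g : B, ‖g‖ = ‖f‖ ∧ ∀ z : ℂ, eval g z = conj (eval f (conj z))

/-- `f^#(z) = conj (f (conj z))`. -/
def sharp (f : ℂ → ℂ) : ℂ → ℂ := fun z => conj (f (conj z))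

/-- Hermite-Biehler functions: entire, and `|e^#(z)| < |e(z)|` (in particular `e(z) ≠ 0`) in the
open upper half-plane. -/
structure IsHermiteBiehler (e : ℂ → ℂ) : Prop where
  differentiable : Differentiable ℂ e
  norm_sharp_lt : ∀ z : ℂ, 0 < z.im → ‖sharp e z‖ < ‖e z‖

/-- The Hardy space `H²` of the open upper half-plane. -/
def hardySet : Set (ℂ → ℂ) :=
  {F | DifferentiableOn ℂ F {z : ℂ | 0 < z.im} ∧
    ∃ C : ℝ≥0, ∀ y : ℝ, 0 < y →
      ∫⁻ x : ℝ, ‖F ((x : ℂ) + (y : ℂ) * Complex.I)‖ₑ ^ 2 ≤ (C : ENNReal)}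

/-- The set of functions of the space `B(e)`: all entire `f` with `f / e` and `f^# / e` in `H²`
of the upper half-plane. -/
def deBrangesSet (e : ℂ → ℂ) : Set (ℂ → ℂ) :=
  {f | Differentiable ℂ f ∧ (fun z => f z / e z) ∈ hardySet ∧
    (fun z => sharp f z / e z) ∈ hardySet}

section Space

variable (B : Type*) [NormedAddCommGroup B] [InnerProductSpace ℂ B] [CompleteSpace B]
  [DeBrangesSpace B]

open DeBrangesSpace

/-- `B = B(e)` as Hilbert spaces, for a Hermite-Biehler function `e` without real zeros. -/
structure IsGeneratedBy (e : ℂ → ℂ) : Prop where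
  hermiteBiehler : IsHermiteBiehler e
  ne_zero : ∀ x : ℝ, e x ≠ 0
  range_eval : Set.range (fun f : B => eval f) = deBrangesSet e
  inner_eq : ∀ f g : B, inner ℂ f g = ∫ x : ℝ, conj (eval f x) * eval g x / ((‖e x‖ ^ 2 : ℝ) : ℂ)

/-- The operator `S` of multiplication by the independent variable, with maximal domain. -/
def mulOp : B →ₗ.[ℂ] B where
  domain :=
    { carrier := {f | ∃ g : B, ∀ z : ℂ, eval g z = z * eval f z}
      add_mem' := by
        rintro f f' ⟨g, hg⟩ ⟨g', hg'⟩
        exact ⟨g + g', fun z => by simp [hg, hg', mul_add]⟩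
      zero_mem' := ⟨0, fun z => by simp⟩
      smul_mem' := by
        rintro c f ⟨g, hg⟩
        exact ⟨c • g, fun z => by simp [hg]; ring⟩ }
  toFun :=
    { toFun := fun f => f.2.choose
      map_add' := fun f g => by
        apply eval_injective
        funext z
        have h1 := (f + g).2.choose_spec z
        have h2 := f.2.choose_spec z
        have h3 := g.2.choose_spec z
        rw [h1, map_add, Pi.add_apply, h2, h3]
        simp [mul_add]
      map_smul' := fun c f => by
        apply eval_injective
        funext z
        have h1 := (c • f).2.choose_spec z
        have h2 := f.2.choose_spec z
        rw [h1, map_smul, Pi.smul_apply]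
        simp only [RingHom.id_apply, smul_eq_mul, h2]
        simp
        ring }

variable {B}

theorem eval_mulOp (f : (mulOp B).domain) (z : ℂ) :
    eval (mulOp B f) z = z * eval (f : B) z :=
  f.2.choose_spec z

/-- Evaluation is continuous at every point, the real ones included: at a real point it is a
pointwise limit of continuous functionals. -/
theorem continuous_eval_all (w : ℂ) : Continuous fun f : B => eval f w := by
  let L : ℂ → B →ₗ[ℂ] ℂ := fun w => (LinearMap.proj w).comp eval
  let u : ℕ → ℂ := fun k => w + ((if 0 ≤ w.im then 1 else -1 : ℝ) * (1 / ((k : ℝ) + 1)) : ℝ) * Complex.I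
  have hu : ∀ k, (u k).im ≠ 0 := by
    intro k
    have hk : (0 : ℝ) < 1 / ((k : ℝ) + 1) := by positivity
    have : (u k).im = w.im + (if 0 ≤ w.im then 1 else -1 : ℝ) * (1 / ((k : ℝ) + 1)) := by
      simp [u, -Complex.ofReal_mul]
    rw [this]
    split_ifs with h
    · have : 0 < w.im + 1 * (1 / ((k : ℝ) + 1)) := by linarith
      exact this.ne'
    · have : w.im + -1 * (1 / ((k : ℝ) + 1)) < 0 := by linarith
      exact this.ne
  have hlim : Filter.Tendsto u Filter.atTop (nhds w) := by
    have h1 : Filter.Tendsto (fun k : ℕ => (1 / ((k : ℝ) + 1))) Filter.atTop (nhds 0) :=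
      tendsto_one_div_add_atTop_nhds_zero_nat
    have h2 : Filter.Tendsto
        (fun k : ℕ => (((if 0 ≤ w.im then 1 else -1 : ℝ) * (1 / ((k : ℝ) + 1)) : ℝ) : ℂ))
        Filter.atTop (nhds ((((if 0 ≤ w.im then 1 else -1 : ℝ) * 0 : ℝ)) : ℂ)) :=
      (Complex.continuous_ofReal.tendsto _).comp (h1.const_mul _)
    have h3 := (h2.mul_const Complex.I).const_add w
    simpa [u] using h3
  let g : ℕ → B →L[ℂ] ℂ := fun k => ⟨L (u k), continuous_eval _ (hu k)⟩
  have hT : Filter.Tendsto (fun k (f : B) => g k f) Filter.atTop (nhds (fun f => L w f)) := by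
    rw [tendsto_pi_nhds]
    intro f
    exact ((differentiable_eval f).continuous.tendsto w).comp hlim
  exact (continuousLinearMapOfTendsto (σ₁₂ := RingHom.id ℂ) g hT).continuous

/-- The reproducing kernel: `kernel w = k(·, w)` is the element of `B` with
`⟨k(·, w), f⟩ = f(w)`. -/
def kernel (w : ℂ) : B :=
  (InnerProductSpace.toDual ℂ B).symm
    ⟨(LinearMap.proj w).comp (eval : B →ₗ[ℂ] (ℂ → ℂ)), continuous_eval_all w⟩

theorem inner_kernel (w : ℂ) (f : B) : inner ℂ (kernel w) f = eval f w := by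
  rw [kernel, InnerProductSpace.toDual_symm_apply]
  rfl

variable (B) in
/-- The `n`-associated functions `assoc_n B = B + z B + ⋯ + z ^ n B`. -/
def assocSubmodule (n : ℕ) : Submodule ℂ (ℂ → ℂ) where
  carrier := {f | ∃ g : Fin (n + 1) → B, ∀ z : ℂ, f z = ∑ j : Fin (n + 1), z ^ (j : ℕ) * eval (g j) z}
  add_mem' := by
    rintro f f' ⟨g, hg⟩ ⟨g', hg'⟩
    exact ⟨g + g', fun z => by simp [hg, hg', mul_add, Finset.sum_add_distrib]⟩
  zero_mem' := ⟨0, fun z => by simp⟩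
  smul_mem' := by
    rintro c f ⟨g, hg⟩
    refine ⟨c • g, fun z => ?_⟩
    simp only [Pi.smul_apply, smul_eq_mul, map_smul, hg, Finset.mul_sum]
    exact Finset.sum_congr rfl fun j _ => by ring

theorem eval_mem_assoc (n : ℕ) (f : B) : (eval f : ℂ → ℂ) ∈ assocSubmodule B n :=
  ⟨Fin.cons f 0, fun z => by simp [Fin.sum_univ_succ]⟩

theorem assoc_le_succ (n : ℕ) : assocSubmodule B n ≤ assocSubmodule B (n + 1) := by
  rintro f ⟨g, hg⟩
  exact ⟨Fin.snoc g 0, fun z => by rw [hg, Fin.sum_univ_castSucc (n := n + 1)]; simp⟩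

theorem mul_mem_assoc {n : ℕ} {f : ℂ → ℂ} (hf : f ∈ assocSubmodule B n) :
    (fun z => z * f z) ∈ assocSubmodule B (n + 1) := by
  obtain ⟨g, hg⟩ := hf
  refine ⟨Fin.cons 0 g, fun z => ?_⟩
  simp only [hg]
  rw [Fin.sum_univ_succ (n := n + 1), Finset.mul_sum]
  simp [pow_succ']
  exact Finset.sum_congr rfl fun j _ => by ring

theorem add_I_mul_mem_assoc {n : ℕ} {f : ℂ → ℂ} (hf : f ∈ assocSubmodule B n) :
    (fun z => (z + Complex.I) * f z) ∈ assocSubmodule B (n + 1) := by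
  have h := add_mem (mul_mem_assoc hf) ((assocSubmodule B (n + 1)).smul_mem Complex.I
    (assoc_le_succ n hf))
  convert h using 1
  funext z
  simp [add_mul]

theorem pow_mul_mem_assoc (n : ℕ) (f : B) :
    (fun z => (z + Complex.I) ^ n * eval f z) ∈ assocSubmodule B n := by
  induction n with
  | zero => simpa using eval_mem_assoc 0 f
  | succ n ih =>
    convert add_I_mul_mem_assoc ih using 1
    funext z
    ring

theorem exists_mem_assoc_succ {n : ℕ} {f : ℂ → ℂ} (hf : f ∈ assocSubmodule B (n + 1)) :
    ∃ (g : B) (f' : ℂ → ℂ), f' ∈ assocSubmodule B n ∧ ∀ z, f z = eval g z + z * f' z := by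
  obtain ⟨g, hg⟩ := hf
  refine ⟨g 0, _, ⟨fun j => g j.succ, fun z => rfl⟩, fun z => ?_⟩
  rw [hg, Fin.sum_univ_succ, Finset.mul_sum]
  simp only [Fin.val_zero, pow_zero, one_mul, Fin.val_succ]
  congr 1
  exact Finset.sum_congr rfl fun j _ => by ring

variable (B) in
theorem exists_codim_one : ∃ f₀ : B, ∀ g : B, ∃ (c : ℂ) (g' : B),
    ∀ z, eval g z = (z + Complex.I) * eval g' z + c * eval f₀ z := by
  have key : ∀ f : B, eval f (-Complex.I) = 0 → ∃ g' : B,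
      ∀ z, eval f z = (z + Complex.I) * eval g' z := by
    intro f hf
    obtain ⟨q, -, hq⟩ := blaschke f (-Complex.I) (by simp) hf
    refine ⟨(1 / (2 * Complex.I)) • (f - q), fun z => ?_⟩
    have h := hq z
    simp only [map_neg, Complex.conj_I, neg_neg, sub_neg_eq_add] at h
    simp only [map_smul, map_sub, Pi.smul_apply, Pi.sub_apply, smul_eq_mul]
    have hI : Complex.I ≠ 0 := Complex.I_ne_zero
    field_simp
    linear_combination h
  by_cases h0 : ∃ f₀ : B, eval f₀ (-Complex.I) ≠ 0
  · obtain ⟨f₀, hf₀⟩ := h0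
    refine ⟨f₀, fun g => ?_⟩
    obtain ⟨g', hg'⟩ := key (g - (eval g (-Complex.I) / eval f₀ (-Complex.I)) • f₀) (by
      simp [hf₀])
    refine ⟨eval g (-Complex.I) / eval f₀ (-Complex.I), g', fun z => ?_⟩
    have h := hg' z
    simp only [map_smul, map_sub, Pi.smul_apply, Pi.sub_apply, smul_eq_mul] at h
    rw [← h]
    ring
  · push Not at h0
    refine ⟨0, fun g => ?_⟩
    obtain ⟨g', hg'⟩ := key g (h0 g)
    exact ⟨0, g', fun z => by simp [hg' z]⟩

variable (B) in
theorem exists_assoc_decomp (n : ℕ) : ∃ F : Submodule ℂ (ℂ → ℂ), FiniteDimensional ℂ F ∧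
    ∀ f ∈ assocSubmodule B n, ∃ (b : B), ∃ p ∈ F,
      ∀ z, f z = (z + Complex.I) ^ n * eval b z + p z := by
  obtain ⟨f₀, hf₀⟩ := exists_codim_one B
  have hQ : ∀ n : ℕ, (∀ f ∈ assocSubmodule B n, ∃ (c : ℂ), ∃ f' ∈ assocSubmodule B n,
        ∀ z, f z = (z + Complex.I) * f' z + c * eval f₀ z) →
      ∀ f ∈ assocSubmodule B (n + 1), ∃ (c : ℂ), ∃ f' ∈ assocSubmodule B n,
        ∀ z, f z = (z + Complex.I) * f' z + c * eval f₀ z := by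
    intro n hn f hf
    obtain ⟨g, f', hf', h⟩ := exists_mem_assoc_succ hf
    obtain ⟨c₀, g', hg'⟩ := hf₀ g
    obtain ⟨c, f'', hf'', h'⟩ := hn f' hf'
    refine ⟨c₀ - Complex.I * c, (eval g' : ℂ → ℂ) + f' - Complex.I • f'',
      sub_mem (add_mem (eval_mem_assoc n g') hf') (Submodule.smul_mem _ _ hf''), fun z => ?_⟩
    simp only [Pi.sub_apply, Pi.add_apply, Pi.smul_apply, smul_eq_mul]
    linear_combination h z + hg' z - Complex.I * h' z
  have hP : ∀ n : ℕ, ∀ f ∈ assocSubmodule B n, ∃ (c : ℂ), ∃ f' ∈ assocSubmodule B n,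
        ∀ z, f z = (z + Complex.I) * f' z + c * eval f₀ z := by
    intro n
    induction n with
    | zero =>
      rintro f ⟨g, hg⟩
      obtain ⟨c, g', hg'⟩ := hf₀ (g 0)
      exact ⟨c, eval g', eval_mem_assoc 0 g', fun z => by simp [hg, hg']⟩
    | succ n ih =>
      intro f hf
      obtain ⟨c, f', hf', h⟩ := hQ n ih f hf
      exact ⟨c, f', assoc_le_succ n hf', h⟩
  induction n with
  | zero =>
    refine ⟨⊥, inferInstance, ?_⟩
    rintro f ⟨g, hg⟩
    exact ⟨g 0, 0, rfl, fun z => by simp [hg]⟩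
  | succ n ih =>
    obtain ⟨F, hF, h⟩ := ih
    let M : (ℂ → ℂ) →ₗ[ℂ] (ℂ → ℂ) := LinearMap.mulLeft ℂ (fun z => z + Complex.I)
    refine ⟨F.map M ⊔ Submodule.span ℂ {(eval f₀ : ℂ → ℂ)}, inferInstance, fun f hf => ?_⟩
    obtain ⟨c, f', hf', h1⟩ := hQ n (hP n) f hf
    obtain ⟨b, p, hp, h2⟩ := h f' hf'
    refine ⟨b, M p + c • (eval f₀ : ℂ → ℂ), Submodule.add_mem_sup (Submodule.mem_map_of_mem hp)
      (Submodule.smul_mem _ _ (Submodule.mem_span_singleton_self _)), fun z => ?_⟩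
    simp only [M, LinearMap.mulLeft_apply, Pi.add_apply, Pi.mul_apply, Pi.smul_apply, smul_eq_mul]
    rw [h1, h2]
    ring

/-- A space that is the sum of a complete and a finite-dimensional subspace is complete. -/
theorem completeSpace_of_add {V : Type*} [NormedAddCommGroup V] [InnerProductSpace ℂ V]
    (W F : Submodule ℂ V) (hW : IsComplete (W : Set V)) [FiniteDimensional ℂ F]
    (h : ∀ v : V, ∃ w ∈ W, ∃ p ∈ F, v = w + p) : CompleteSpace V := by
  let i : V →ₗᵢ[ℂ] UniformSpace.Completion V := UniformSpace.Completion.toComplₗᵢ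
  have hc : IsClosed ((W.map i.toLinearMap : Submodule ℂ (UniformSpace.Completion V)) :
      Set (UniformSpace.Completion V)) := by
    apply IsComplete.isClosed
    have := (isComplete_image_iff (s := (W : Set V)) i.isometry.isUniformInducing).2 hW
    simpa using this
  have hc2 := Submodule.isClosed_sup_finiteDimensional _ (F.map i.toLinearMap) hc
  have hsurj : Function.Surjective i := by
    intro x
    have hx : x ∈ closure (Set.range i) := UniformSpace.Completion.denseRange_coe x
    have hsub : Set.range i ⊆ ((W.map i.toLinearMap ⊔ F.map i.toLinearMap :
        Submodule ℂ (UniformSpace.Completion V)) : Set (UniformSpace.Completion V)) := by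
      rintro _ ⟨v, rfl⟩
      obtain ⟨w, hw, p, hp, rfl⟩ := h v
      rw [map_add]
      exact Submodule.add_mem_sup (Submodule.mem_map_of_mem hw) (Submodule.mem_map_of_mem hp)
    have hx2 := closure_minimal hsub hc2 hx
    obtain ⟨_, ⟨w, -, rfl⟩, _, ⟨p, -, rfl⟩, rfl⟩ := Submodule.mem_sup.1 hx2
    exact ⟨w + p, map_add _ _ _⟩
  exact (i.isometry.isUniformEmbedding.completeSpace_congr hsurj).2 inferInstance

/-! ### The spaces `B_{-n}` -/

variable {e : ℂ → ℂ}

/-- The space `B_{-n}`: the `n`-associated functions of `B = B(e)`. Its inner product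
`∫ conj f(x) g(x) / ((x ^ 2 + 1) ^ n |e(x)| ^ 2) dx` depends on `e` and is introduced below. -/
def Minus (_he : IsGeneratedBy B e) (n : ℕ) : Type := assocSubmodule B n

section Minus

variable (he : IsGeneratedBy B e) (n : ℕ)

instance : AddCommGroup (Minus he n) := inferInstanceAs (AddCommGroup (assocSubmodule B n))
instance : Module ℂ (Minus he n) := inferInstanceAs (Module ℂ (assocSubmodule B n))

/-- Elements of `B_{-n}` are functions on `ℂ`. -/
instance : FunLike (Minus he n) ℂ ℂ where
  coe f := (show assocSubmodule B n from f).1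
  coe_injective := fun _ _ h => Subtype.ext h

variable {he n}

@[ext] theorem Minus.ext {f g : Minus he n} (h : ∀ z, f z = g z) : f = g :=
  DFunLike.ext f g h

@[simp] theorem Minus.add_apply (f g : Minus he n) (z : ℂ) : (f + g) z = f z + g z := rfl
@[simp] theorem Minus.smul_apply (c : ℂ) (f : Minus he n) (z : ℂ) : (c • f) z = c * f z := rfl

theorem Minus.exists_rep (f : Minus he n) :
    ∃ g : Fin (n + 1) → B, ∀ z, f z = ∑ j : Fin (n + 1), z ^ (j : ℕ) * eval (g j) z := f.2

theorem continuous_e (he : IsGeneratedBy B e) : Continuous fun x : ℝ => e x :=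
  he.hermiteBiehler.differentiable.continuous.comp Complex.continuous_ofReal

theorem Minus.continuous (f : Minus he n) : Continuous fun x : ℝ => f x := by
  obtain ⟨g, hg⟩ := f.exists_rep
  simp only [hg]
  refine continuous_finsetSum _ fun j _ => ?_
  have := (differentiable_eval (g j)).continuous.comp Complex.continuous_ofReal
  exact (Complex.continuous_ofReal.pow _).mul this

theorem Minus.differentiable (f : Minus he n) : Differentiable ℂ f := by
  obtain ⟨g, hg⟩ := f.exists_rep
  have : (f : ℂ → ℂ) = fun z => ∑ j : Fin (n + 1), z ^ (j : ℕ) * eval (g j) z := funext hg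
  rw [this]
  have := fun j => differentiable_eval (g j)
  fun_prop

/-- The weight `(x ^ 2 + 1) ^ n |e(x)| ^ 2`. -/
def weight (e : ℂ → ℂ) (n : ℕ) (x : ℝ) : ℝ := (x ^ 2 + 1) ^ n * ‖e x‖ ^ 2

theorem weight_pos (he : IsGeneratedBy B e) (n : ℕ) (x : ℝ) : 0 < weight e n x := by
  have := norm_pos_iff.2 (he.ne_zero x)
  unfold weight
  positivity

theorem continuous_weight (he : IsGeneratedBy B e) (n : ℕ) : Continuous (weight e n) := by
  have := (continuous_e he).norm
  unfold weight
  fun_prop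

theorem integrable_eval (he : IsGeneratedBy B e) (f : B) :
    MeasureTheory.Integrable fun x : ℝ => ‖eval f x‖ ^ 2 / ‖e x‖ ^ 2 := by
  by_cases hf : f = 0
  · simp [hf]
  have h : ∫ x : ℝ, conj (eval f x) * eval f x / ((‖e x‖ ^ 2 : ℝ) : ℂ) ≠ 0 := by
    rw [← he.inner_eq]
    simpa using hf
  have h2 := (not_imp_comm.1 MeasureTheory.integral_undef h).norm
  refine h2.congr (Filter.Eventually.of_forall fun x => ?_)
  simp [sq]

theorem Minus.integrable_sq (f : Minus he n) :
    MeasureTheory.Integrable fun x : ℝ => ‖f x‖ ^ 2 / weight e n x := by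
  obtain ⟨g, hg⟩ := f.exists_rep
  have hI : MeasureTheory.Integrable fun x : ℝ =>
      ((n : ℝ) + 1) * ∑ j : Fin (n + 1), ‖eval (g j) x‖ ^ 2 / ‖e x‖ ^ 2 :=
    (MeasureTheory.integrable_finsetSum _ fun j _ => integrable_eval he (g j)).const_mul _
  refine hI.mono' ?_ (Filter.Eventually.of_forall fun x => ?_)
  · exact ((f.continuous.norm.pow 2).div (continuous_weight he n)
      fun x => (weight_pos he n x).ne').aestronglyMeasurable
  have hw := weight_pos he n x
  have hex : 0 < ‖e x‖ ^ 2 := by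
    have := norm_pos_iff.2 (he.ne_zero x)
    positivity
  rw [Real.norm_of_nonneg (by positivity), div_le_iff₀ hw, hg]
  have h1 : ‖∑ j : Fin (n + 1), (x : ℂ) ^ (j : ℕ) * eval (g j) x‖ ^ 2 ≤
      (∑ j : Fin (n + 1), ‖(x : ℂ) ^ (j : ℕ) * eval (g j) x‖) ^ 2 := by
    gcongr
    exact norm_sum_le _ _
  have h2 := sq_sum_le_card_mul_sum_sq (s := (Finset.univ : Finset (Fin (n + 1))))
    (f := fun j => ‖(x : ℂ) ^ (j : ℕ) * eval (g j) x‖)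
  refine (h1.trans h2).trans ?_
  simp only [Finset.card_univ, Fintype.card_fin, Nat.cast_add, Nat.cast_one]
  rw [mul_assoc]
  refine mul_le_mul_of_nonneg_left ?_ (by positivity)
  rw [Finset.sum_mul]
  refine Finset.sum_le_sum fun j _ => ?_
  have h3 : ‖eval (g j) (x : ℂ)‖ ^ 2 / ‖e x‖ ^ 2 * weight e n x =
      ‖eval (g j) (x : ℂ)‖ ^ 2 * (x ^ 2 + 1) ^ n := by
    have hne := he.ne_zero x
    have hne' : ‖e x‖ ≠ 0 := norm_ne_zero_iff.2 hne
    unfold weight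
    field_simp
  rw [h3, norm_mul, mul_pow, mul_comm]
  refine mul_le_mul_of_nonneg_left ?_ (by positivity)
  rw [norm_pow, Complex.norm_real, ← pow_mul, mul_comm, pow_mul, Real.norm_eq_abs, sq_abs]
  calc (x ^ 2) ^ (j : ℕ) ≤ (x ^ 2 + 1) ^ (j : ℕ) := by gcongr; linarith
    _ ≤ (x ^ 2 + 1) ^ n := pow_le_pow_right₀ (by nlinarith [sq_nonneg x]) (by omega)

theorem Minus.integrable_mul (f g : Minus he n) :
    MeasureTheory.Integrable fun x : ℝ => conj (f x) * g x / (weight e n x : ℂ) := by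
  refine (f.integrable_sq.add g.integrable_sq).mono' ?_ (Filter.Eventually.of_forall fun x => ?_)
  · have hc : Continuous fun x : ℝ => (weight e n x : ℂ) :=
      Complex.continuous_ofReal.comp (continuous_weight he n)
    exact (((Complex.continuous_conj.comp f.continuous).mul g.continuous).div hc
      fun x => by exact_mod_cast (weight_pos he n x).ne').aestronglyMeasurable
  have hw := weight_pos he n x
  simp only [norm_div, norm_mul, RCLike.norm_conj, Complex.norm_real, Pi.add_apply]
  rw [Real.norm_of_nonneg hw.le, ← add_div]
  gcongr
  nlinarith [sq_nonneg (‖f x‖ - ‖g x‖), sq_nonneg ‖f x‖, sq_nonneg ‖g x‖]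

variable (he n) in
/-- The inner product of `B_{-n}`,
`⟨f, g⟩_{-n} = ∫ conj f(x) g(x) / ((x ^ 2 + 1) ^ n |e(x)| ^ 2) dx`. -/
@[reducible] def minusCore : InnerProductSpace.Core ℂ (Minus he n) where
  inner f g := ∫ x : ℝ, conj (f x) * g x / (((x ^ 2 + 1) ^ n * ‖e x‖ ^ 2 : ℝ) : ℂ)
  conj_inner_symm f g := by
    rw [← integral_conj]
    congr 1
    funext x
    simp [mul_comm]
  re_inner_nonneg f := by
    have h : (∫ x : ℝ, conj (f x) * f x / (((x ^ 2 + 1) ^ n * ‖e x‖ ^ 2 : ℝ) : ℂ)) =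
        ((∫ x : ℝ, ‖f x‖ ^ 2 / weight e n x : ℝ) : ℂ) := by
      rw [← integral_complex_ofReal]
      congr 1
      funext x
      rw [mul_comm, Complex.mul_conj, Complex.normSq_eq_norm_sq]
      push_cast [weight]
      rfl
    rw [h]
    simp only [RCLike.re_to_complex, Complex.ofReal_re]
    exact MeasureTheory.integral_nonneg fun x => div_nonneg (by positivity) (weight_pos he n x).le
  add_left f g k := by
    refine Eq.trans ?_ (MeasureTheory.integral_add (f.integrable_mul k) (g.integrable_mul k))
    congr 1
    funext x
    simp [add_mul, add_div]
  smul_left f g c := by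
    rw [← MeasureTheory.integral_const_mul]
    congr 1
    funext x
    simp [mul_assoc, mul_div_assoc]
  definite f hf := by
    have h : (∫ x : ℝ, conj (f x) * f x / (((x ^ 2 + 1) ^ n * ‖e x‖ ^ 2 : ℝ) : ℂ)) =
        ((∫ x : ℝ, ‖f x‖ ^ 2 / weight e n x : ℝ) : ℂ) := by
      rw [← integral_complex_ofReal]
      congr 1
      funext x
      rw [mul_comm, Complex.mul_conj, Complex.normSq_eq_norm_sq]
      push_cast [weight]
      rfl
    have hf' : (∫ x : ℝ, ‖f x‖ ^ 2 / weight e n x) = 0 := by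
      have := h.symm.trans hf
      exact_mod_cast this
    have hcont : Continuous fun x : ℝ => ‖f x‖ ^ 2 / weight e n x :=
      (f.continuous.norm.pow 2).div (continuous_weight he n) fun x => (weight_pos he n x).ne'
    have h0 := (MeasureTheory.integral_eq_zero_iff_of_nonneg
      (fun x => div_nonneg (by positivity) (weight_pos he n x).le) f.integrable_sq).1 hf'
    have h1 := (hcont.ae_eq_iff_eq (μ := MeasureTheory.volume) continuous_const).1 h0
    have h2 : ∀ x : ℝ, f x = 0 := by
      intro x
      have h4 : ‖f x‖ ^ 2 / weight e n x = 0 := congrFun h1 x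
      simpa [(weight_pos he n x).ne'] using h4
    have h3 : Set.EqOn (f : ℂ → ℂ) 0 Set.univ := by
      refine AnalyticOnNhd.eqOn_of_preconnected_of_frequently_eq (z₀ := 0)
        (fun z _ => f.differentiable.analyticAt z) (fun z _ => analyticAt_const)
        isPreconnected_univ (Set.mem_univ _) ?_
      have ht : Filter.Tendsto (fun k : ℕ => ((1 / ((k : ℝ) + 1) : ℝ) : ℂ)) Filter.atTop
          (nhdsWithin 0 {0}ᶜ) := by
        refine tendsto_nhdsWithin_iff.2 ⟨?_, Filter.Eventually.of_forall fun k => ?_⟩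
        · rw [← Complex.ofReal_zero]
          exact (Complex.continuous_ofReal.tendsto _).comp
            tendsto_one_div_add_atTop_nhds_zero_nat
        · have : (1 / ((k : ℝ) + 1) : ℝ) ≠ 0 := by positivity
          exact Complex.ofReal_ne_zero.2 this
      exact ht.frequently (Filter.Frequently.of_forall fun k => h2 _)
    exact Minus.ext fun z => h3 (Set.mem_univ z)

instance : NormedAddCommGroup (Minus he n) := (minusCore he n).toNormedAddCommGroup
instance : InnerProductSpace ℂ (Minus he n) := InnerProductSpace.ofCore (minusCore he n).toCore

theorem minus_inner_eq (f g : Minus he n) : inner ℂ f g =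
    ∫ x : ℝ, conj (f x) * g x / (((x ^ 2 + 1) ^ n * ‖e x‖ ^ 2 : ℝ) : ℂ) := rfl

theorem minus_norm_sq (f : Minus he n) : ‖f‖ ^ 2 = ∫ x : ℝ, ‖f x‖ ^ 2 / weight e n x := by
  have h : inner ℂ f f = ((∫ x : ℝ, ‖f x‖ ^ 2 / weight e n x : ℝ) : ℂ) := by
    rw [minus_inner_eq, ← integral_complex_ofReal]
    congr 1
    funext x
    rw [mul_comm, Complex.mul_conj, Complex.normSq_eq_norm_sq]
    push_cast [weight]
    rfl
  rw [inner_self_eq_norm_sq_to_K] at h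
  apply Complex.ofReal_injective
  rw [Complex.ofReal_pow]
  exact h

theorem norm_sq_eq (he : IsGeneratedBy B e) (f : B) :
    ‖f‖ ^ 2 = ∫ x : ℝ, ‖eval f x‖ ^ 2 / ‖e x‖ ^ 2 := by
  have h : inner ℂ f f = ((∫ x : ℝ, ‖eval f x‖ ^ 2 / ‖e x‖ ^ 2 : ℝ) : ℂ) := by
    rw [he.inner_eq, ← integral_complex_ofReal]
    congr 1
    funext x
    rw [mul_comm, Complex.mul_conj, Complex.normSq_eq_norm_sq]
    push_cast
    rfl
  rw [inner_self_eq_norm_sq_to_K] at h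
  apply Complex.ofReal_injective
  rw [Complex.ofReal_pow]
  exact h

variable (he n) in
/-- Multiplication by `(z + i) ^ n` is isometric from `B` to `B_{-n}`. -/
def mulPow : B →ₗᵢ[ℂ] Minus he n where
  toFun f := (⟨_, pow_mul_mem_assoc n f⟩ : assocSubmodule B n)
  map_add' f g := Minus.ext fun z => by
    change (z + Complex.I) ^ n * eval (f + g) z =
      (z + Complex.I) ^ n * eval f z + (z + Complex.I) ^ n * eval g z
    rw [map_add, Pi.add_apply, mul_add]
  map_smul' c f := Minus.ext fun z => by
    change (z + Complex.I) ^ n * eval (c • f) z = c * ((z + Complex.I) ^ n * eval f z)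
    rw [map_smul, Pi.smul_apply, smul_eq_mul]
    ring
  norm_map' f := by
    rw [← sq_eq_sq₀ (norm_nonneg _) (norm_nonneg _), norm_sq_eq he]
    refine (minus_norm_sq _).trans ?_
    congr 1
    funext x
    change ‖((x : ℂ) + Complex.I) ^ n * eval f x‖ ^ 2 / weight e n x = _
    have h1 : ‖(x : ℂ) + Complex.I‖ ^ 2 = x ^ 2 + 1 := by
      rw [← Complex.normSq_eq_norm_sq]
      simp [Complex.normSq_apply, sq]
    have h2 : 0 < x ^ 2 + 1 := by positivity
    rw [norm_mul, mul_pow, norm_pow, ← pow_mul, mul_comm n, pow_mul, h1, weight,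
      mul_div_mul_left _ _ (pow_pos h2 n).ne']

theorem mulPow_apply (f : B) (z : ℂ) : mulPow he n f z = (z + Complex.I) ^ n * eval f z := rfl

/-- `B_{-n}` is a Hilbert space. -/
instance : CompleteSpace (Minus he n) := by
  obtain ⟨F, hF, h⟩ := exists_assoc_decomp B n
  let incl : Minus he n →ₗ[ℂ] (ℂ → ℂ) := (assocSubmodule B n).subtype
  have hincl : Function.Injective incl := Subtype.val_injective
  have : FiniteDimensional ℂ (F.comap incl) :=
    FiniteDimensional.of_injective
      ((incl.restrict (p := F.comap incl) (q := F) fun _ hx => hx)) fun a b hab =>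
        Subtype.ext (hincl (congrArg (fun t : F => (t : ℂ → ℂ)) hab))
  refine completeSpace_of_add (LinearMap.range (mulPow he n).toLinearMap) (F.comap incl) ?_ ?_
  · have := (completeSpace_iff_isComplete_range
      (mulPow he n).isometry.isUniformInducing).1 inferInstance
    exact this
  · intro v
    obtain ⟨b, p, hp, hv⟩ := h (incl v) v.2
    refine ⟨mulPow he n b, ⟨b, rfl⟩, v - mulPow he n b, ?_, by abel⟩
    have : incl (v - mulPow he n b) = p := by
      funext z
      change incl v z - (z + Complex.I) ^ n * eval b z = p z
      rw [hv]
      ring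
    change incl _ ∈ F
    rw [this]
    exact hp

end Minus

/-! ### The Gelfand triplet -/

section Triplet

variable (he : IsGeneratedBy B e) (n : ℕ)

/-- The immersion of `B` into `B_{-n}`. -/
def immersion : B →L[ℂ] Minus he n :=
  LinearMap.mkContinuous
    { toFun := fun f => (⟨eval f, eval_mem_assoc n f⟩ : assocSubmodule B n)
      map_add' := fun f g => Minus.ext fun z => by
        change eval (f + g) z = eval f z + eval g z
        rw [map_add, Pi.add_apply]
      map_smul' := fun c f => Minus.ext fun z => by
        change eval (c • f) z = c * eval f z
        rw [map_smul, Pi.smul_apply, smul_eq_mul] } 1 fun f => by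
    rw [one_mul, ← sq_le_sq₀ (norm_nonneg _) (norm_nonneg _), norm_sq_eq he]
    refine (minus_norm_sq _).trans_le ?_
    refine MeasureTheory.integral_mono (Minus.integrable_sq _) (integrable_eval he f) fun x => ?_
    have hex : 0 < ‖e x‖ := norm_pos_iff.2 (he.ne_zero x)
    have h1 : (1 : ℝ) ≤ (x ^ 2 + 1) ^ n := one_le_pow₀ (by nlinarith [sq_nonneg x])
    change ‖eval f x‖ ^ 2 / weight e n x ≤ ‖eval f x‖ ^ 2 / ‖e x‖ ^ 2
    unfold weight
    gcongr
    nlinarith [sq_nonneg ‖e x‖]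

theorem immersion_apply (f : B) (z : ℂ) : immersion he n f z = eval f z := rfl

theorem immersion_injective : Function.Injective (immersion he n) := fun f g h =>
  eval_injective (funext fun z => by rw [← immersion_apply he n, h, immersion_apply])

theorem norm_immersion_le (f : B) : ‖immersion he n f‖ ≤ ‖f‖ := by
  have := (immersion he n).le_of_opNorm_le (LinearMap.mkContinuous_norm_le _ zero_le_one _) f
  simpa using this

/-- The operator `D : B_{-n} → B`, the adjoint of the immersion of `B` into `B_{-n}`:
`⟨g, D f⟩ = ⟨g, f⟩_{-n}` for `g` in `B` and `f` in `B_{-n}`. -/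
def opD : Minus he n →L[ℂ] B := ContinuousLinearMap.adjoint (immersion he n)

theorem inner_opD (g : B) (f : Minus he n) :
    inner ℂ g (opD he n f) = inner ℂ (immersion he n g) f :=
  ContinuousLinearMap.adjoint_inner_right _ _ _

/-- The restriction of `D` to `B`. -/
def opDRestrict : B →ₗ[ℂ] B := (opD he n).toLinearMap.comp (immersion he n).toLinearMap

theorem opDRestrict_apply (f : B) : opDRestrict he n f = opD he n (immersion he n f) := rfl

theorem opDRestrict_injective : Function.Injective (opDRestrict he n) := by
  rw [← LinearMap.ker_eq_bot, LinearMap.ker_eq_bot']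
  intro f hf
  have h := inner_opD he n f (immersion he n f)
  rw [← opDRestrict_apply, hf, inner_zero_right] at h
  apply immersion_injective he n
  rw [map_zero]
  exact inner_self_eq_zero.1 h.symm

/-- The pre-Hilbert space `B_{+n}^pre = D B`, with the inner product
`⟨f, g⟩_{+n} = ⟨f, D⁻¹ g⟩` introduced below. -/
def PrePlus : Type _ := LinearMap.range (opDRestrict he n)

instance : AddCommGroup (PrePlus he n) :=
  inferInstanceAs (AddCommGroup (LinearMap.range (opDRestrict he n)))
instance : Module ℂ (PrePlus he n) :=
  inferInstanceAs (Module ℂ (LinearMap.range (opDRestrict he n)))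

/-- The inclusion of `B_{+n}^pre` into `B`. -/
def prePlusVal : PrePlus he n →ₗ[ℂ] B := (LinearMap.range (opDRestrict he n)).subtype

/-- The operator `D⁻¹` from `B_{+n}^pre = D B` to `B`. -/
def opDInv : PrePlus he n →ₗ[ℂ] B :=
  (LinearEquiv.ofInjective (opDRestrict he n) (opDRestrict_injective he n)).symm.toLinearMap

variable {he n}

theorem opD_opDInv (g : PrePlus he n) :
    opD he n (immersion he n (opDInv he n g)) = prePlusVal he n g :=
  congrArg Subtype.val
    ((LinearEquiv.ofInjective (opDRestrict he n) (opDRestrict_injective he n)).apply_symm_apply g)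

theorem inner_val_opDInv (f g : PrePlus he n) :
    inner ℂ (prePlusVal he n f) (opDInv he n g) =
      inner ℂ (immersion he n (opDInv he n f)) (immersion he n (opDInv he n g)) := by
  rw [← opD_opDInv, ← inner_conj_symm, inner_opD, inner_conj_symm]

variable (he n)

/-- The inner product `⟨f, g⟩_{+n} = ⟨f, D⁻¹ g⟩` of `B_{+n}^pre`. -/
@[reducible] def prePlusCore : InnerProductSpace.Core ℂ (PrePlus he n) where
  inner f g := inner ℂ (prePlusVal he n f) (opDInv he n g)
  conj_inner_symm f g := by
    rw [inner_val_opDInv, inner_val_opDInv, inner_conj_symm]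
  re_inner_nonneg f := by
    rw [inner_val_opDInv]
    exact inner_self_nonneg
  add_left f g k := by rw [map_add, inner_add_left]
  smul_left f g c := by rw [map_smul, inner_smul_left]
  definite f hf := by
    rw [inner_val_opDInv] at hf
    have h := inner_self_eq_zero.1 hf
    rw [← map_zero (immersion he n)] at h
    have h2 := immersion_injective he n h
    rw [← map_zero (opDInv he n)] at h2
    exact LinearEquiv.injective _ h2

instance : NormedAddCommGroup (PrePlus he n) := (prePlusCore he n).toNormedAddCommGroup
instance : InnerProductSpace ℂ (PrePlus he n) := InnerProductSpace.ofCore (prePlusCore he n).toCore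

theorem prePlus_inner_eq (f g : PrePlus he n) :
    inner ℂ f g = inner ℂ (prePlusVal he n f) (opDInv he n g) := rfl

theorem norm_immersion_opDInv (f : PrePlus he n) : ‖immersion he n (opDInv he n f)‖ = ‖f‖ := by
  rw [← sq_eq_sq₀ (norm_nonneg _) (norm_nonneg _)]
  have h := (prePlus_inner_eq he n f f).trans (inner_val_opDInv f f)
  rw [inner_self_eq_norm_sq_to_K, inner_self_eq_norm_sq_to_K] at h
  exact_mod_cast h.symm

theorem norm_prePlusVal_le (f : PrePlus he n) : ‖prePlusVal he n f‖ ≤ ‖f‖ := by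
  have hι : ‖immersion he n‖ ≤ 1 := LinearMap.mkContinuous_norm_le _ zero_le_one _
  have hD : ‖opD he n‖ ≤ 1 := by
    rw [opD, LinearIsometryEquiv.norm_map]
    exact hι
  have h := (opD he n).le_of_opNorm_le hD (immersion he n (opDInv he n f))
  rwa [opD_opDInv, one_mul, norm_immersion_opDInv] at h

/-- The space `B_{+n}`: the completion of `B_{+n}^pre`. -/
abbrev Plus : Type _ := UniformSpace.Completion (PrePlus he n)

/-- The operator `T^pre`: the map `D⁻¹` regarded as an isometry from `B_{+n}^pre` to `B_{-n}`. -/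
def opTPre : PrePlus he n →L[ℂ] Minus he n :=
  LinearMap.mkContinuous ((immersion he n).toLinearMap.comp (opDInv he n)) 1 fun f => by
    rw [one_mul]
    exact (norm_immersion_opDInv he n f).le

/-- The operator `T : B_{+n} → B_{-n}`, the extension of `T^pre` by continuity. -/
def opT : Plus he n →L[ℂ] Minus he n :=
  (opTPre he n).extend (UniformSpace.Completion.toComplL : PrePlus he n →L[ℂ] Plus he n)

theorem opT_coe (f : PrePlus he n) :
    opT he n (f : Plus he n) = immersion he n (opDInv he n f) :=
  ContinuousLinearMap.extend_eq (opTPre he n)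
    (e := (UniformSpace.Completion.toComplL : PrePlus he n →L[ℂ] Plus he n))
    UniformSpace.Completion.denseRange_coe
    (UniformSpace.Completion.isUniformInducing_coe _) f

/-- The canonical map from `B_{+n}` to `B`, through which `B_{+n}` is regarded as a subspace of
`B`: the extension by continuity of the inclusion of `B_{+n}^pre` into `B`. -/
def plusToSpace : Plus he n →L[ℂ] B :=
  (LinearMap.mkContinuous (prePlusVal he n) 1 fun f => by
    rw [one_mul]
    exact norm_prePlusVal_le he n f).extend
    (UniformSpace.Completion.toComplL : PrePlus he n →L[ℂ] Plus he n)

theorem plusToSpace_coe (f : PrePlus he n) :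
    plusToSpace he n (f : Plus he n) = prePlusVal he n f :=
  ContinuousLinearMap.extend_eq _
    (e := (UniformSpace.Completion.toComplL : PrePlus he n →L[ℂ] Plus he n))
    UniformSpace.Completion.denseRange_coe
    (UniformSpace.Completion.isUniformInducing_coe _) f

variable {he n}

/-- The duality bracket `[h, f] = ⟨T h, f⟩_{-n}` of `B_{+n}` and `B_{-n}`. -/
def bracket (h : Plus he n) (f : Minus he n) : ℂ := inner ℂ (opT he n h) f

end Triplet

end Space

end DeBranges

end

/-!
The range of `S - w` consists of the functions of `B` that vanish at `w`: a zero of a function of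
the space can be divided out within the space (`exists_eval_eq_sub_mul`), by the Blaschke axiom if
it is not real, and by an estimate in the Hardy space if it is real, since `e` has no real zeros.
The same fact shows that the functions of `B` have no common zero. Hence `S` is always regular,
closed and symmetric with deficiency indices `(1, 1)`, and a vector `v` spans a complement of the
range of `S - w` if and only if `v(w) ≠ 0`. Applied to `v = ∑ w ^ j μ j`, this says that
`S` is `n`-entire if and only if some `m(z) = ∑ z ^ j (μ j)(z)` in `B_{-n}` has no zeros
(`isNEntire_mulOp_iff`).

The other half identifies `[k(·, z), m]` with `m(z)`. Point evaluations are continuous on `B_{-n}`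
because `(z + i) ^ n B` is a complete subspace of finite codimension, so `B_{-n}` has a
reproducing kernel of its own (`minusKernel`), and `D` maps it to `k(·, z)` (`opD_minusKernel`).
Since `S` is densely defined, `B` is dense in `B_{-n}` (`denseRange_immersion`), so that `D` is
injective and the isometry `T` is onto. The map from `B_{+n}` to `B` is `D T` (`plusToSpace_eq`);
it is therefore injective, and it takes `T⁻¹` of the kernel of `B_{-n}` to `k(·, z)`.
-/

noncomputable section

namespace DeBranges

open DeBrangesSpace

/-! ### Dividing out zeros -/

theorem differentiable_sharp {f : ℂ → ℂ} (hf : Differentiable ℂ f) : Differentiable ℂ (sharp f) :=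
  fun z => by
    have h := (hf (conj z)).conj_conj
    rwa [Complex.conj_conj] at h

/-- A Hermite-Biehler function without real zeros has no zero in the closed upper half-plane. -/
theorem IsHermiteBiehler.ne_zero_of_im_nonneg {e : ℂ → ℂ} (he : IsHermiteBiehler e)
    (hreal : ∀ x : ℝ, e x ≠ 0) {z : ℂ} (hz : 0 ≤ z.im) : e z ≠ 0 := by
  rcases hz.eq_or_lt with h | h
  · have : z = (z.re : ℂ) := Complex.ext rfl (by simp [← h])
    rw [this]
    exact hreal _
  · exact norm_pos_iff.1 ((norm_nonneg _).trans_lt (he.norm_sharp_lt z h))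

/-- Membership in `H²` survives division by `z - x₀`, `x₀` real, as long as the quotient extends
continuously to the real line: away from `x₀` the quotient is dominated by the original function,
and near `x₀` it is bounded. -/
theorem mem_hardySet_of_sub_mul {F G : ℂ → ℂ} (x₀ : ℝ) (hF : F ∈ hardySet)
    (hG : DifferentiableOn ℂ G {z : ℂ | 0 < z.im}) (hGc : ContinuousOn G {z : ℂ | 0 ≤ z.im})
    (h : ∀ z : ℂ, F z = (z - x₀) * G z) : G ∈ hardySet := by
  obtain ⟨-, C, hC⟩ := hF
  have hK : IsCompact (Metric.closedBall (x₀ : ℂ) 1 ∩ {z : ℂ | 0 ≤ z.im}) :=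
    (isCompact_closedBall _ _).inter_right (isClosed_le continuous_const Complex.continuous_im)
  obtain ⟨M, hM⟩ := hK.exists_bound_of_continuousOn (hGc.mono Set.inter_subset_right)
  refine ⟨hG, C + M.toNNReal ^ 2 * 2, fun y hy => ?_⟩
  have hpt : ∀ x : ℝ, ‖G ((x : ℂ) + (y : ℂ) * Complex.I)‖ₑ ^ 2 ≤
      ‖F ((x : ℂ) + (y : ℂ) * Complex.I)‖ₑ ^ 2 +
        (Set.Icc (x₀ - 1) (x₀ + 1)).indicator (fun _ => ((M.toNNReal ^ 2 : ℝ≥0) : ENNReal)) x := by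
    intro x
    set z : ℂ := (x : ℂ) + (y : ℂ) * Complex.I with hz
    have him : z.im = y := by simp [hz]
    have hre : z.re = x := by simp [hz]
    by_cases hd : ‖z - x₀‖ ≤ 1
    · have hGM : ‖G z‖ ≤ M :=
        hM z ⟨by rwa [Metric.mem_closedBall, dist_eq_norm], by simpa [him] using hy.le⟩
      have hx : x ∈ Set.Icc (x₀ - 1) (x₀ + 1) := by
        have := (Complex.abs_re_le_norm (z - x₀)).trans hd
        rw [Complex.sub_re, hre, Complex.ofReal_re, abs_le] at this
        constructor <;> linarith [this.1, this.2]
      rw [Set.indicator_of_mem hx]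
      refine le_add_left ?_
      rw [ENNReal.coe_pow]
      gcongr
      rw [← ofReal_norm, ← ENNReal.ofReal]
      exact ENNReal.ofReal_le_ofReal hGM
    · refine le_add_right ?_
      gcongr
      rw [h, enorm_mul]
      refine le_mul_of_one_le_left' ?_
      rw [← ofReal_norm]
      exact ENNReal.one_le_ofReal.2 (not_le.1 hd).le
  refine (MeasureTheory.lintegral_mono hpt).trans ?_
  rw [MeasureTheory.lintegral_add_right _ (measurable_const.indicator measurableSet_Icc),
    MeasureTheory.lintegral_indicator_const measurableSet_Icc, Real.volume_Icc]
  have h2 : ENNReal.ofReal (x₀ + 1 - (x₀ - 1)) = ((2 : ℝ≥0) : ENNReal) := by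
    rw [show x₀ + 1 - (x₀ - 1) = ((2 : ℝ≥0) : ℝ) by push_cast; ring, ENNReal.ofReal_coe_nnreal]
  rw [h2, ENNReal.coe_add, ENNReal.coe_mul]
  gcongr
  exact hC y hy

variable {B : Type*} [NormedAddCommGroup B] [InnerProductSpace ℂ B] [CompleteSpace B]
  [DeBrangesSpace B] {e : ℂ → ℂ}

/-- A zero at any point, real or not, can be divided out within the space. For non-real `w` this is
the Blaschke axiom; for real `w` it needs `e w ≠ 0`. -/
theorem exists_eval_eq_sub_mul (he : IsGeneratedBy B e) (f : B) (w : ℂ) (hf : eval f w = 0) :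
    ∃ g : B, ∀ z, eval f z = (z - w) * eval g z := by
  by_cases hw : w.im = 0
  · have hwr : w = (w.re : ℂ) := Complex.ext rfl (by simp [hw])
    set g : ℂ → ℂ := dslope (eval f) w with hg
    have hgd : Differentiable ℂ g := by
      rw [← differentiableOn_univ, hg, Complex.differentiableOn_dslope Filter.univ_mem]
      exact (differentiable_eval f).differentiableOn
    have hfg : ∀ z, eval f z = (z - w) * g z := fun z => by
      rw [hg, ← smul_eq_mul, sub_smul_dslope, hf, sub_zero]
    have hfg' : ∀ z, sharp (eval f) z = (z - w) * sharp g z := fun z => by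
      have : conj w = w := Complex.conj_eq_iff_im.2 hw
      rw [sharp, hfg, map_mul, map_sub, Complex.conj_conj, this, sharp]
    obtain ⟨-, h1, h2⟩ : (eval f : ℂ → ℂ) ∈ deBrangesSet e := he.range_eval ▸ ⟨f, rfl⟩
    have hed := he.hermiteBiehler.differentiable
    have he0 : ∀ z : ℂ, 0 ≤ z.im → e z ≠ 0 :=
      fun z => he.hermiteBiehler.ne_zero_of_im_nonneg he.ne_zero
    have hdiv : ∀ F G : ℂ → ℂ, (fun z => F z / e z) ∈ hardySet → Differentiable ℂ G →
        (∀ z, F z = (z - w) * G z) → (fun z => G z / e z) ∈ hardySet := by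
      intro F G hF hG hFG
      refine mem_hardySet_of_sub_mul w.re hF ?_ ?_ fun z => ?_
      · exact hG.differentiableOn.div hed.differentiableOn fun z hz => he0 z (le_of_lt hz)
      · exact hG.continuous.continuousOn.div hed.continuous.continuousOn fun z hz => he0 z hz
      · rw [← hwr, hFG, mul_div_assoc]
    have hmem : g ∈ deBrangesSet e :=
      ⟨hgd, hdiv _ _ h1 hgd hfg, hdiv _ _ h2 (differentiable_sharp hgd) hfg'⟩
    rw [← he.range_eval] at hmem
    obtain ⟨q, hq⟩ := hmem
    exact ⟨q, fun z => by rw [hfg, ← hq]⟩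
  · obtain ⟨q, -, hq⟩ := blaschke f w hw hf
    have hne : w - conj w ≠ 0 := sub_ne_zero.2 fun h => hw (Complex.conj_eq_iff_im.1 h.symm)
    refine ⟨(w - conj w)⁻¹ • (q - f), fun z => ?_⟩
    simp only [map_smul, map_sub, Pi.smul_apply, Pi.sub_apply, smul_eq_mul]
    field_simp
    linear_combination -hq z

/-- The functions of the space have no common zero: otherwise every one of them could be divided
by `z - w` arbitrarily often. -/
theorem exists_eval_ne_zero (he : IsGeneratedBy B e) (w : ℂ) : ∃ f : B, eval f w ≠ 0 := by
  by_contra! h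
  obtain ⟨f, hf⟩ := exists_ne_zero (B := B)
  have hpow : ∀ k : ℕ, ∃ g : B, ∀ z, eval f z = (z - w) ^ k * eval g z := by
    intro k
    induction k with
    | zero => exact ⟨f, fun z => by simp⟩
    | succ k ih =>
      obtain ⟨g, hg⟩ := ih
      obtain ⟨g', hg'⟩ := exists_eval_eq_sub_mul he g w (h g)
      exact ⟨g', fun z => by rw [hg, hg', pow_succ, mul_assoc]⟩
  have han : ∀ g : B, ∀ z, AnalyticAt ℂ (eval g) z := fun g z =>
    (differentiable_eval g).analyticAt z
  have htop : analyticOrderAt (eval f) w = ⊤ := by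
    refine ENat.eq_top_iff_forall_ge.2 fun k => ?_
    obtain ⟨g, hg⟩ := hpow k
    exact (natCast_le_analyticOrderAt (han f w)).2
      ⟨eval g, han g w, Filter.Eventually.of_forall fun z => hg z⟩
  rw [AnalyticOnNhd.analyticOrderAt_eq_top_iff_eq_zero w (han f)] at htop
  exact hf (eval_injective (htop.trans (map_zero eval).symm))

/-! ### The operator of multiplication by the independent variable -/

theorem mem_shiftRange_mulOp (he : IsGeneratedBy B e) {w : ℂ} {f : B} :
    f ∈ shiftRange (mulOp B) w ↔ eval f w = 0 := by
  constructor
  · rintro ⟨g, rfl⟩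
    change eval (mulOp B g - w • (g : B)) w = 0
    simp [eval_mulOp]
  · intro hf
    obtain ⟨g, hg⟩ := exists_eval_eq_sub_mul he f w hf
    have hS : ∀ z, eval (f + w • g) z = z * eval g z := fun z => by
      simp [hg]
      ring
    refine ⟨⟨g, f + w • g, hS⟩, eval_injective (funext fun z => ?_)⟩
    change eval (mulOp B _ - w • g) z = _
    simp [eval_mulOp, hg]
    ring

theorem mem_graph_mulOp {p : B × B} :
    p ∈ (mulOp B).graph ↔ ∀ z : ℂ, eval p.2 z = z * eval p.1 z := by
  rw [LinearPMap.mem_graph_iff]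
  constructor
  · rintro ⟨y, hy1, hy2⟩ z
    rw [← hy1, ← hy2, eval_mulOp]
  · exact fun h => ⟨⟨p.1, p.2, h⟩, rfl, eval_injective (funext fun z => by rw [eval_mulOp, h])⟩

variable (B) in
theorem isClosed_mulOp : (mulOp B).IsClosed := by
  have : ((mulOp B).graph : Set (B × B)) =
      ⋂ z : ℂ, {p | eval p.2 z = z * eval p.1 z} := by
    ext p
    rw [Set.mem_iInter]
    exact mem_graph_mulOp
  rw [LinearPMap.IsClosed, this]
  exact isClosed_iInter fun z => isClosed_eq ((continuous_eval_all z).comp continuous_snd)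
    (((continuous_eval_all z).comp continuous_fst).const_mul z)

theorem mulOp_symmetric (he : IsGeneratedBy B e) (f g : (mulOp B).domain) :
    inner ℂ (mulOp B f) (g : B) = inner ℂ (f : B) (mulOp B g) := by
  rw [he.inner_eq, he.inner_eq]
  congr 1
  funext x
  rw [eval_mulOp, eval_mulOp, map_mul, Complex.conj_ofReal]
  ring

variable (B) in
theorem isClosed_setOf_eval_eq_zero (w : ℂ) : IsClosed {f : B | eval f w = 0} :=
  isClosed_eq (continuous_eval_all w) continuous_const

theorem shiftRange_mulOp_eq_orthogonal (he : IsGeneratedBy B e) (w : ℂ) :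
    shiftRange (mulOp B) w = (Submodule.span ℂ {(kernel w : B)})ᗮ := by
  ext f
  rw [mem_shiftRange_mulOp he, Submodule.mem_orthogonal_singleton_iff_inner_right, inner_kernel]

theorem finrank_orthogonal_shiftRange_mulOp (he : IsGeneratedBy B e) (w : ℂ) :
    Module.finrank ℂ (shiftRange (mulOp B) w)ᗮ = 1 := by
  rw [shiftRange_mulOp_eq_orthogonal he, Submodule.orthogonal_orthogonal]
  refine finrank_span_singleton fun h => ?_
  obtain ⟨f, hf⟩ := exists_eval_ne_zero he w
  rw [← inner_kernel, h, inner_zero_left] at hf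
  exact hf rfl

/-- Regularity of `S`: the bounded map `(f, S f) ↦ (S - w) f` from the graph of `S` to the
closed range of `S - w` is onto, hence open, and it is injective. -/
theorem mulOp_regular (he : IsGeneratedBy B e) (w : ℂ) :
    ∃ d : ℝ, 0 < d ∧ ∀ f : (mulOp B).domain, d * ‖(f : B)‖ ≤ ‖mulOp B f - w • (f : B)‖ := by
  let N : Submodule ℂ B := shiftRange (mulOp B) w
  have hN : IsClosed (N : Set B) := by
    convert isClosed_setOf_eval_eq_zero B w using 1
    ext f
    exact mem_shiftRange_mulOp he
  have : CompleteSpace N := hN.completeSpace_coe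
  have : CompleteSpace (mulOp B).graph := (isClosed_mulOp B).completeSpace_coe
  let Φ₀ : (mulOp B).graph →L[ℂ] B :=
    (ContinuousLinearMap.snd ℂ B B - w • ContinuousLinearMap.fst ℂ B B).comp
      (mulOp B).graph.subtypeL
  have hΦ₀ : ∀ p : (mulOp B).graph, Φ₀ p = p.1.2 - w • p.1.1 := fun p => rfl
  have hΦz : ∀ p z, eval (Φ₀ p) z = (z - w) * eval p.1.1 z := fun p z => by
    rw [hΦ₀, map_sub, map_smul, Pi.sub_apply, Pi.smul_apply, smul_eq_mul,
      mem_graph_mulOp.1 p.2, sub_mul]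
  let Φ : (mulOp B).graph →L[ℂ] N :=
    Φ₀.codRestrict N fun p => (mem_shiftRange_mulOp he).2 (by rw [hΦz]; simp)
  have hsurj : Function.Surjective Φ := by
    rintro ⟨_, g, rfl⟩
    exact ⟨⟨(g, mulOp B g), (mulOp B).mem_graph g⟩, rfl⟩
  have hker : ∀ p, Φ₀ p = 0 → p.1.1 = 0 := by
    intro p hp
    refine eval_injective ?_
    rw [map_zero]
    refine Continuous.ext_on (dense_compl_singleton w) (differentiable_eval _).continuous
      continuous_const fun z hz => ?_
    have h := hΦz p z
    rw [hp, map_zero, Pi.zero_apply, eq_comm, mul_eq_zero] at h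
    exact h.resolve_left (sub_ne_zero.2 hz)
  obtain ⟨C, hC, h⟩ := Φ.exists_preimage_norm_le hsurj
  refine ⟨C⁻¹, inv_pos.2 hC, fun f => ?_⟩
  let p : (mulOp B).graph := ⟨(f, mulOp B f), (mulOp B).mem_graph f⟩
  obtain ⟨q, hq, hqn⟩ := h (Φ p)
  have hpq : p.1.1 = q.1.1 := by
    refine sub_eq_zero.1 (hker (p - q) ?_)
    rw [map_sub, sub_eq_zero]
    exact congrArg Subtype.val hq.symm
  rw [inv_mul_le_iff₀ hC]
  calc ‖(f : B)‖ = ‖q.1.1‖ := congrArg norm hpq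
    _ ≤ ‖q‖ := norm_fst_le q.1
    _ ≤ C * ‖mulOp B f - w • (f : B)‖ := hqn

theorem isRegularSymmetric_mulOp (he : IsGeneratedBy B e) : IsRegularSymmetric (mulOp B) where
  closed := isClosed_mulOp B
  symmetric := mulOp_symmetric he
  deficiency w _ := finrank_orthogonal_shiftRange_mulOp he w
  regular := mulOp_regular he

theorem isCompl_shiftRange_mulOp_span_iff (he : IsGeneratedBy B e) (w : ℂ) (v : B) :
    IsCompl (shiftRange (mulOp B) w) (Submodule.span ℂ {v}) ↔ eval v w ≠ 0 := by
  constructor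
  · intro h hv
    obtain ⟨f, hf⟩ := exists_eval_ne_zero he w
    have hle : Submodule.span ℂ {v} ≤ shiftRange (mulOp B) w := by
      rw [Submodule.span_singleton_le_iff_mem]
      exact (mem_shiftRange_mulOp he).2 hv
    have htop : shiftRange (mulOp B) w = ⊤ := by
      rw [← sup_eq_left.2 hle]
      exact h.sup_eq_top
    exact hf ((mem_shiftRange_mulOp he).1 (htop ▸ Submodule.mem_top))
  · intro hv
    constructor
    · rw [Submodule.disjoint_def]
      intro f hf hf'
      obtain ⟨c, rfl⟩ := Submodule.mem_span_singleton.1 hf'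
      have := (mem_shiftRange_mulOp he).1 hf
      rw [map_smul, Pi.smul_apply, smul_eq_mul, mul_eq_zero] at this
      rw [this.resolve_right hv, zero_smul]
    · rw [codisjoint_iff, Submodule.eq_top_iff']
      intro f
      refine Submodule.mem_sup.2 ⟨f - (eval f w / eval v w) • v, ?_, (eval f w / eval v w) • v,
        Submodule.smul_mem _ _ (Submodule.mem_span_singleton_self v), by abel⟩
      rw [mem_shiftRange_mulOp he]
      simp [hv]

/-- `S` is `n`-entire if and only if some `n`-associated function `m = ∑ z ^ j μ j` has no zeros:
the same `μ j` serve in both conditions, as `∑ z ^ j μ j` spans a complement of the functions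
vanishing at `z` exactly when its own value at `z` is not zero. -/
theorem isNEntire_mulOp_iff (he : IsGeneratedBy B e) (n : ℕ) :
    IsNEntire n (mulOp B) ↔ ∃ m : Minus he n, ∀ z : ℂ, m z ≠ 0 := by
  have key : ∀ (μ : Fin (n + 1) → B) (z : ℂ),
      eval (∑ j : Fin (n + 1), z ^ (j : ℕ) • μ j) z =
        ∑ j : Fin (n + 1), z ^ (j : ℕ) * eval (μ j) z := fun μ z => by
    simp [map_sum, Finset.sum_apply]
  simp only [IsNEntire, isRegularSymmetric_mulOp he, true_and,
    isCompl_shiftRange_mulOp_span_iff he, key]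
  constructor
  · rintro ⟨μ, hμ⟩
    exact ⟨(⟨_, μ, fun z => rfl⟩ : assocSubmodule B n), hμ⟩
  · rintro ⟨m, hm⟩
    obtain ⟨μ, hμ⟩ := m.exists_rep
    exact ⟨μ, fun z => hμ z ▸ hm z⟩

/-! ### Point evaluations in `B_{-n}` -/

variable (he : IsGeneratedBy B e) (n : ℕ)

/-- Evaluation at a point is continuous on `B_{-n}`: it is so on the complete subspace
`(z + i) ^ n B`, whose codimension is finite. -/
theorem Minus.continuous_eval (w : ℂ) : Continuous fun f : Minus he n => f w := by
  obtain ⟨F, hF, h⟩ := exists_assoc_decomp B n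
  let incl : Minus he n →ₗ[ℂ] (ℂ → ℂ) := (assocSubmodule B n).subtype
  let F' : Submodule ℂ (Minus he n) := F.comap incl
  have : FiniteDimensional ℂ F' :=
    FiniteDimensional.of_injective (incl.restrict (p := F') (q := F) fun _ hx => hx)
      fun a b hab => Subtype.ext (Subtype.val_injective
        (congrArg (fun t : F => (t : ℂ → ℂ)) hab))
  let Φ : B × F' →L[ℂ] Minus he n :=
    (mulPow he n).toContinuousLinearMap.coprod F'.subtypeL
  have : CompleteSpace F' := FiniteDimensional.complete ℂ F'
  have hsurj : Function.Surjective Φ := by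
    intro v
    obtain ⟨b, p, hp, hv⟩ := h (incl v) v.2
    have hmem : v - mulPow he n b ∈ F' := by
      have : incl (v - mulPow he n b) = p := by
        funext z
        change incl v z - (z + Complex.I) ^ n * eval b z = p z
        rw [hv]
        ring
      change incl _ ∈ F
      rwa [this]
    exact ⟨(b, ⟨_, hmem⟩), add_sub_cancel _ _⟩
  -- By the open mapping theorem it is enough to test continuity after composition with `Φ`.
  rw [(Φ.isQuotientMap hsurj).continuous_iff]
  let L : F' →ₗ[ℂ] ℂ :=
    { toFun := fun p => (p : Minus he n) w
      map_add' := fun _ _ => rfl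
      map_smul' := fun _ _ => rfl }
  have hL : Continuous L := L.continuous_of_finiteDimensional
  exact (((continuous_eval_all w).comp continuous_fst).const_mul ((w + Complex.I) ^ n)).add
    (hL.comp continuous_snd)

/-- The reproducing kernel of `B_{-n}`. -/
def minusKernel (w : ℂ) : Minus he n :=
  (InnerProductSpace.toDual ℂ (Minus he n)).symm
    ⟨{ toFun := fun f => f w
       map_add' := fun _ _ => rfl
       map_smul' := fun _ _ => rfl }, Minus.continuous_eval he n w⟩

theorem inner_minusKernel (w : ℂ) (f : Minus he n) : inner ℂ (minusKernel he n w) f = f w := by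
  rw [minusKernel, InnerProductSpace.toDual_symm_apply]
  rfl

theorem opD_minusKernel (w : ℂ) : opD he n (minusKernel he n w) = kernel w := by
  refine ext_inner_left ℂ fun g => ?_
  rw [inner_opD, ← inner_conj_symm, inner_minusKernel, immersion_apply, ← inner_kernel,
    inner_conj_symm]

/-! ### Density of `B` in `B_{-n}` -/

variable {n} in
theorem minus_norm_le {m : ℕ} {f : Minus he n} {g : Minus he m}
    (h : ∀ x : ℝ, ‖g x‖ ^ 2 / weight e m x ≤ ‖f x‖ ^ 2 / weight e n x) : ‖g‖ ≤ ‖f‖ := by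
  rw [← sq_le_sq₀ (norm_nonneg _) (norm_nonneg _), minus_norm_sq, minus_norm_sq]
  exact MeasureTheory.integral_mono g.integrable_sq f.integrable_sq h

theorem weight_succ (x : ℝ) : weight e (n + 1) x = (x ^ 2 + 1) * weight e n x := by
  unfold weight
  ring

/-- The inclusion of `B_{-n}` into `B_{-(n+1)}`. -/
def minusSucc : Minus he n →L[ℂ] Minus he (n + 1) :=
  LinearMap.mkContinuous
    { toFun := fun f => (⟨f, assoc_le_succ n f.2⟩ : assocSubmodule B (n + 1))
      map_add' := fun _ _ => rfl
      map_smul' := fun _ _ => rfl } 1 fun f => by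
    rw [one_mul]
    refine minus_norm_le he fun x => ?_
    have hw := weight_pos he n x
    change ‖f x‖ ^ 2 / _ ≤ _
    rw [weight_succ]
    gcongr
    nlinarith [sq_nonneg x]

/-- Multiplication by `z + i`, from `B_{-n}` to `B_{-(n+1)}`. -/
def minusMul : Minus he n →L[ℂ] Minus he (n + 1) :=
  LinearMap.mkContinuous
    { toFun := fun f => (⟨_, add_I_mul_mem_assoc f.2⟩ : assocSubmodule B (n + 1))
      map_add' := fun f g => Minus.ext fun z => mul_add (z + Complex.I) (f z) (g z)
      map_smul' := fun c f => Minus.ext fun z => mul_left_comm (z + Complex.I) c (f z) } 1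
    fun f => by
    rw [one_mul]
    refine minus_norm_le he fun x => le_of_eq ?_
    change ‖((x : ℂ) + Complex.I) * f x‖ ^ 2 / _ = _
    have h1 : ‖(x : ℂ) + Complex.I‖ ^ 2 = x ^ 2 + 1 := by
      rw [← Complex.normSq_eq_norm_sq]
      simp [Complex.normSq_apply, sq]
    have h2 : x ^ 2 + 1 ≠ 0 := by positivity
    rw [weight_succ, norm_mul, mul_pow, h1, mul_div_mul_left _ _ h2]

theorem minusMul_apply (f : Minus he n) (z : ℂ) :
    minusMul he n f z = (z + Complex.I) * f z := rfl

/-- If `S` is densely defined, then `B` is dense in every `B_{-n}`. For the step from `n` to `n + 1`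
an element of `B_{-(n+1)}` is written as `h + (z + i) f`, with `h` and `f` in `B_{-n}`: both are
approximated by elements of `B`, and in the second term even by elements `d` of the domain of `S`,
for which `(z + i) d` is again in `B`. -/
theorem denseRange_immersion (hS : Dense ((mulOp B).domain : Set B)) :
    DenseRange (immersion he n) := by
  induction n with
  | zero =>
    refine Function.Surjective.denseRange fun f => ?_
    obtain ⟨g, hg⟩ := f.exists_rep
    exact ⟨g 0, Minus.ext fun z => by simp [hg, immersion_apply]⟩
  | succ n ih =>
    let K : Submodule ℂ (Minus he (n + 1)) :=
      (LinearMap.range (immersion he (n + 1)).toLinearMap).topologicalClosure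
    have hK : IsClosed (K : Set (Minus he (n + 1))) := Submodule.isClosed_topologicalClosure _
    have hmem : ∀ b, immersion he (n + 1) b ∈ K := fun b =>
      Submodule.le_topologicalClosure _ ⟨b, rfl⟩
    have hincl : ∀ f, minusSucc he n f ∈ K := fun f =>
      ih.induction_on f (hK.preimage (minusSucc he n).continuous) hmem
    have hmulB : ∀ b, minusMul he n (immersion he n b) ∈ K := by
      intro b
      refine hS.induction (fun d hd => ?_) (hK.preimage
        ((minusMul he n).continuous.comp (immersion he n).continuous)) b
      have : minusMul he n (immersion he n d) =
          immersion he (n + 1) (mulOp B ⟨d, hd⟩ + Complex.I • d) := by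
        ext z
        rw [minusMul_apply, immersion_apply, immersion_apply, map_add, Pi.add_apply, eval_mulOp,
          map_smul, Pi.smul_apply, smul_eq_mul, add_mul]
      rw [this]
      exact hmem _
    have hmul : ∀ f, minusMul he n f ∈ K := fun f =>
      ih.induction_on f (hK.preimage (minusMul he n).continuous) hmulB
    intro f
    obtain ⟨g, f', hf', h⟩ := exists_mem_assoc_succ f.2
    let F : Minus he n := (⟨f', hf'⟩ : assocSubmodule B n)
    have hf : f = immersion he (n + 1) g + minusMul he n F - Complex.I • minusSucc he n F := by
      refine Minus.ext fun z => (h z).trans ?_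
      change eval g z + z * f' z = eval g z + (z + Complex.I) * f' z - Complex.I * f' z
      ring
    rw [hf]
    exact K.sub_mem (K.add_mem (hmem g) (hmul F)) (K.smul_mem _ (hincl F))

/-! ### The Gelfand triplet -/

theorem norm_opT (h : Plus he n) : ‖opT he n h‖ = ‖h‖ := by
  induction h using UniformSpace.Completion.induction_on with
  | hp => exact isClosed_eq (opT he n).continuous.norm continuous_norm
  | ih f => rw [opT_coe, norm_immersion_opDInv, UniformSpace.Completion.norm_coe]

theorem opDInv_surjective : Function.Surjective (opDInv he n) := LinearEquiv.surjective _

theorem opT_surjective (hS : Dense ((mulOp B).domain : Set B)) :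
    Function.Surjective (opT he n) := by
  have hiso : Isometry (opT he n) := AddMonoidHomClass.isometry_of_norm _ (norm_opT he n)
  have hdense : DenseRange (opT he n) := by
    refine (denseRange_immersion he n hS).mono ?_
    rintro _ ⟨b, rfl⟩
    obtain ⟨f, rfl⟩ := opDInv_surjective he n b
    exact ⟨f, opT_coe he n f⟩
  rw [← Set.range_eq_univ, ← hiso.isClosedEmbedding.isClosed_range.closure_eq]
  exact hdense.closure_range

/-- The inclusion of `B_{+n}` into `B` factors through `B_{-n}`. -/
theorem plusToSpace_eq (h : Plus he n) : plusToSpace he n h = opD he n (opT he n h) := by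
  induction h using UniformSpace.Completion.induction_on with
  | hp =>
    exact isClosed_eq (plusToSpace he n).continuous
      ((opD he n).continuous.comp (opT he n).continuous)
  | ih f => rw [plusToSpace_coe, opT_coe, opD_opDInv]

theorem opD_injective (hS : Dense ((mulOp B).domain : Set B)) :
    Function.Injective (opD he n) := by
  refine (injective_iff_map_eq_zero _).2 fun f hf => ?_
  refine (denseRange_immersion he n hS).eq_zero_of_inner_right ℂ fun g => ?_
  rw [← inner_opD, hf, inner_zero_right]

theorem plusToSpace_injective (hS : Dense ((mulOp B).domain : Set B)) :
    Function.Injective (plusToSpace he n) := by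
  have hT : Function.Injective (opT he n) :=
    (AddMonoidHomClass.isometry_of_norm _ (norm_opT he n)).injective
  intro f g h
  rw [plusToSpace_eq, plusToSpace_eq] at h
  exact hT (opD_injective he n hS h)

end DeBranges

end

theorem mainTheorem10 {B : Type*} [NormedAddCommGroup B] [InnerProductSpace ℂ B] [CompleteSpace B]
    [DeBranges.DeBrangesSpace B] {e : ℂ → ℂ} (he : DeBranges.IsGeneratedBy B e)
    (hS : Dense ((DeBranges.mulOp B).domain : Set B)) (n : ℕ) :
    Function.Injective (DeBranges.plusToSpace he n) ∧
    ∃ k : ℂ → DeBranges.Plus he n,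
      (∀ z : ℂ, DeBranges.plusToSpace he n (k z) = DeBranges.kernel z) ∧
      (DeBranges.IsNEntire n (DeBranges.mulOp B) ↔
        ∃ m : DeBranges.Minus he n, ∀ z : ℂ, DeBranges.bracket (k z) m ≠ 0) := by
  refine ⟨DeBranges.plusToSpace_injective he n hS, ?_⟩
  choose k hk using fun z : ℂ =>
    DeBranges.opT_surjective he n hS (DeBranges.minusKernel he n z)
  refine ⟨k, fun z => ?_, ?_⟩
  · rw [DeBranges.plusToSpace_eq, hk, DeBranges.opD_minusKernel]
  · simp only [DeBranges.bracket, hk, DeBranges.inner_minusKernel]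
    exact DeBranges.isNEntire_mulOp_iff he n
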